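/- Let $L$ be a (possibly many-sorted) first-order signature with equality. Positive formulas are built from atomic formulas with $\wedge,\vee,\top,\bot,\exists$; a positive theory is a set of h-inductive sentences $\forall x\,(\phi(x)\to\psi(x))$ with $\phi,\psi$ positive. A positive theory $T$ is $\mathsf{NIP}$ if there are no positive formulas $\phi(x;y),\psi(x;y)$ ($x,y$ finite tuples) with $T\models\neg\exists x,y\,(\phi\wedge\psi)$, model $A\models T$ and tuples $(a_i)_{i\in\omega}$, $(b_W)_{W\subseteq\omega}$ in $A$ such that $A\models\phi(a_i;b_W)$ whenever $i\in W$ and $A\models\psi(a_i;b_W)$ whenever $i\notin W$. Let $T$ be a positive theory with the joint continuation property (any two models of $T$ admit homomorphisms into a common model of $T$), let $\bar\kappa>|L|+\aleph_0$ be a cardinal, where $|L|$ is the number of sorts and symbols of $L$, and call a set small if its cardinality is less than $\bar\kappa$. Let $\mathfrak U$ be a monster model of $T$: a model of $T$ such that every homomorphism from $\mathfrak U$ to a model of $T$ reflects all positive formulas; such that every partial map $\mathfrak U\to\mathfrak U$ with small domain that preserves and reflects all positive formulas extends to an automorphism; and such that every small, finitely satisfiable set of positive formulas with parameters in $\mathfrak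 U$ is satisfiable in $\mathfrak U$. Let $(E_i)_{i\in I}$ be any family of sets $E_i(x_i,x_i')$ of positive $L$-formulas without parameters, where $x_i,x_i'$ are small (possibly infinite) tuples of variables of the same sorts, each defining an equivalence relation on the $x_i$-tuples of $\mathfrak U$. Let $\mathfrak U^{\mathrm{heq}}$ be the many-sorted structure consisting of $\mathfrak U$ with its $L$-structure, together with, for each $i\in I$, a new sort whose elements are the $E_i$-classes of $x_i$-tuples of $\mathfrak U$, and, for every finite sequence of (old or new) sorts and every positive $L$-formula $\phi(x^1,\dots,x^n)$, where $x^k$ is the tuple of variables of the home sorts corresponding to the $k$-th sort (a single variable if that sort is old), a relation $R_\phi$ such that $R_\phi(c_1,\dots,c_n)$ holds if and only if $\mathfrak U\models\phi(a_1,\dots,a_n)$ for some representatives $a_k$ of $c_k$ (with $a_k=c_k$ if the $k$-th sort is old). Let $T^{\mathrm{heq}}$ be the positive theory of all h-inductive sentences true in $\mathfrak U^{\mathrm{heq}}$. If $T$ is $\mathsf{NIP}$, then $T^{\mathrm{heq}}$ is also $\mathsf{NIP}$. -/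

import Mathlib

universe u

namespace PosLogic

/-! ### Many-sorted signatures and structures -/

/-- A many-sorted signature: sorts, function symbols and relation symbols of finite arity
(constants are function symbols of arity `0`). Equality is always a logical symbol. -/
structure Signature where
  Srt : Type u
  Fn : Type u
  fnArity : Fn → ℕ
  fnDom : (f : Fn) → Fin (fnArity f) → Srt
  fnCod : Fn → Srt
  Rel : Type u
  relArity : Rel → ℕ
  relDom : (R : Rel) → Fin (relArity R) → Srt

/-- The number of symbols of a signature, sorts included. -/
def Signature.card (L : Signature.{u}) : Cardinal.{u} :=
  Cardinal.mk L.Srt + Cardinal.mk L.Fn + Cardinal.mk L.Rel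

/-- A structure for a many-sorted signature. -/
structure Struc (L : Signature.{u}) where
  carrier : L.Srt → Type u
  fn : (f : L.Fn) → (∀ k, carrier (L.fnDom f k)) → carrier (L.fnCod f)
  rel : (R : L.Rel) → (∀ k, carrier (L.relDom R k)) → Prop

/-- Terms in free variables `v : V` (of sort `σ v`) and bound variables listed in `Γ`. -/
inductive Term (L : Signature.{u}) {V : Type u} (σ : V → L.Srt) (Γ : List L.Srt) :
    L.Srt → Type u
  | fvar (v : V) : Term L σ Γ (σ v)
  | bvar (k : Fin Γ.length) : Term L σ Γ (Γ.get k)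
  | app (f : L.Fn) (args : ∀ k, Term L σ Γ (L.fnDom f k)) : Term L σ Γ (L.fnCod f)

/-- Positive formulas in free variables `v : V` (of sort `σ v`) and bound variables listed in `Γ`
(de Bruijn style: `ex` binds the first variable of the list). -/
inductive BForm (L : Signature.{u}) {V : Type u} (σ : V → L.Srt) : List L.Srt → Type u
  | eq {Γ : List L.Srt} {s : L.Srt} (t₁ t₂ : Term L σ Γ s) : BForm L σ Γ
  | rel {Γ : List L.Srt} (R : L.Rel) (args : ∀ k, Term L σ Γ (L.relDom R k)) : BForm L σ Γ
  | top {Γ : List L.Srt} : BForm L σ Γ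
  | bot {Γ : List L.Srt} : BForm L σ Γ
  | and {Γ : List L.Srt} (φ ψ : BForm L σ Γ) : BForm L σ Γ
  | or {Γ : List L.Srt} (φ ψ : BForm L σ Γ) : BForm L σ Γ
  | ex {Γ : List L.Srt} (s : L.Srt) (φ : BForm L σ (s :: Γ)) : BForm L σ Γ

/-- Positive formulas `φ(x)` with free variables `x = (v : V)`, the variable `v` of sort `σ v`. -/
abbrev PosForm (L : Signature.{u}) {V : Type u} (σ : V → L.Srt) : Type u := BForm L σ []

variable {L : Signature.{u}}

/-- Tuples of elements of `A` matching a tuple of sorted variables. -/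
abbrev Tuple (A : Struc L) {V : Type*} (σ : V → L.Srt) := ∀ v, A.carrier (σ v)

/-- Concatenation of two tuples. -/
def Tuple.append {A : Struc L} {V W : Type*} {σ : V → L.Srt} {τ : W → L.Srt}
    (a : Tuple A σ) (b : Tuple A τ) : Tuple A (Sum.elim σ τ)
  | Sum.inl v => a v
  | Sum.inr w => b w

/-- The value of a term. -/
def Term.val (A : Struc L) {V : Type u} {σ : V → L.Srt} {Γ : List L.Srt}
    (a : Tuple A σ) (e : Tuple A Γ.get) : {s : L.Srt} → Term L σ Γ s → A.carrier s
  | _, .fvar v => a v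
  | _, .bvar k => e k
  | _, .app f args => A.fn f (fun k => (args k).val A a e)

/-- Satisfaction of a positive formula. -/
def BForm.Holds (A : Struc L) {V : Type u} {σ : V → L.Srt} (a : Tuple A σ) :
    {Γ : List L.Srt} → BForm L σ Γ → Tuple A Γ.get → Prop
  | _, .eq t₁ t₂, e => t₁.val A a e = t₂.val A a e
  | _, .rel R args, e => A.rel R (fun k => (args k).val A a e)
  | _, .top, _ => True
  | _, .bot, _ => False
  | _, .and φ ψ, e => φ.Holds A a e ∧ ψ.Holds A a e
  | _, .or φ ψ, e => φ.Holds A a e ∨ ψ.Holds A a e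
  | Γ, .ex s φ, e => ∃ x : A.carrier s,
      φ.Holds A a (Fin.cons (α := fun k => A.carrier ((s :: Γ).get k)) x e)

/-- `A ⊨ φ(a)`. -/
def Sat (A : Struc L) {V : Type u} {σ : V → L.Srt} (φ : PosForm L σ) (a : Tuple A σ) : Prop :=
  φ.Holds A a (fun k => k.elim0)

/-! ### Positive theories -/

/-- An h-inductive sentence `∀ x, (φ(x) → ψ(x))`, with `x` the finite list of variables `ctx` and
`φ`, `ψ` positive formulas without further free variables. -/
structure HSentence (L : Signature.{u}) where
  ctx : List L.Srt
  hyp : BForm L (V := PEmpty.{u+1}) (fun v => v.elim) ctx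
  concl : BForm L (V := PEmpty.{u+1}) (fun v => v.elim) ctx

/-- Truth of an h-inductive sentence in a structure. -/
def HSentence.True (A : Struc L) (θ : HSentence L) : Prop :=
  ∀ e : Tuple A θ.ctx.get,
    θ.hyp.Holds A (fun v => v.elim) e → θ.concl.Holds A (fun v => v.elim) e

/-- A positive theory is a set of h-inductive sentences. -/
abbrev Theory (L : Signature.{u}) := Set (HSentence L)

/-- `A ⊨ T`. -/
def Theory.Models (T : Theory L) (A : Struc L) : Prop := ∀ θ ∈ T, θ.True A

/-- Homomorphisms of structures. -/
structure Hom (A B : Struc L) where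
  map : ∀ s, A.carrier s → B.carrier s
  map_fn : ∀ (f : L.Fn) (a : ∀ k, A.carrier (L.fnDom f k)),
    map _ (A.fn f a) = B.fn f (fun k => map _ (a k))
  map_rel : ∀ (R : L.Rel) (a : ∀ k, A.carrier (L.relDom R k)),
    A.rel R a → B.rel R (fun k => map _ (a k))

/-- A homomorphism is an immersion if it reflects all positive formulas. -/
def Hom.IsImmersion {A B : Struc L} (f : Hom A B) : Prop :=
  ∀ {V : Type u} (σ : V → L.Srt) (φ : PosForm L σ) (a : Tuple A σ),
    Sat B φ (fun v => f.map _ (a v)) → Sat A φ a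

/-- Positively existentially closed models of `T`. -/
def Theory.IsPec (T : Theory L) (M : Struc L) : Prop :=
  T.Models M ∧ ∀ (A : Struc L), T.Models A → ∀ f : Hom M A, f.IsImmersion

/-- The joint continuation property. -/
def Theory.JCP (T : Theory L) : Prop :=
  ∀ A₁ A₂ : Struc L, T.Models A₁ → T.Models A₂ →
    ∃ B : Struc L, T.Models B ∧ Nonempty (Hom A₁ B) ∧ Nonempty (Hom A₂ B)

/-- Monster models of `T`, where "small" means of cardinality smaller than `κ`. -/
structure Theory.IsMonster (T : Theory L) (κ : Cardinal.{u}) (U : Struc L) : Prop where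
  pec : T.IsPec U
  /-- Every partial immersion with small domain (given by enumerating its graph as `a v ↦ b v`)
  extends to an automorphism. -/
  homogeneous : ∀ {V : Type u} (σ : V → L.Srt), Cardinal.mk V < κ → ∀ a b : Tuple U σ,
    (∀ φ : PosForm L σ, Sat U φ a ↔ Sat U φ b) →
      ∃ f g : Hom U U, (∀ s x, g.map s (f.map s x) = x) ∧ (∀ s x, f.map s (g.map s x) = x) ∧
        ∀ v, f.map _ (a v) = b v
  /-- Every finitely satisfiable small set of positive formulas over `U`, in any tuple of
  variables, is satisfiable. The parameters are substituted for variables indexed by all the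
  elements of `U`. -/
  saturated : ∀ {V : Type u} (σ : V → L.Srt)
    (S : Set (PosForm L (Sum.elim σ (fun p : (s : L.Srt) × U.carrier s => p.1)))),
    Cardinal.mk S < κ →
    (∀ F ⊆ S, F.Finite → ∃ a : Tuple U σ, ∀ φ ∈ F, Sat U φ (Tuple.append a (fun p => p.2))) →
      ∃ a : Tuple U σ, ∀ φ ∈ S, Sat U φ (Tuple.append a (fun p => p.2))

/-! ### The independence property -/

/-- `T ⊨ ∀ x, ¬ (φ(x) ∧ ψ(x))`. -/
def Theory.Contradictory (T : Theory L) {V : Type u} {σ : V → L.Srt} (φ ψ : PosForm L σ) : Prop :=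
  ∀ A : Struc L, T.Models A → ∀ a : Tuple A σ, ¬ (Sat A φ a ∧ Sat A ψ a)

/-- The positive formula `φ(x;y)` has the independence property in `T`. -/
def Theory.HasIP (T : Theory L) {X Y : Type u} {σ : X → L.Srt} {τ : Y → L.Srt}
    (φ : PosForm L (Sum.elim σ τ)) : Prop :=
  ∃ (ψ : PosForm L (Sum.elim σ τ)) (A : Struc L) (a : ℕ → Tuple A σ) (b : Set ℕ → Tuple A τ),
    T.Contradictory φ ψ ∧ T.Models A ∧
      ∀ (i : ℕ) (W : Set ℕ),
        (i ∈ W → Sat A φ ((a i).append (b W))) ∧ (i ∉ W → Sat A ψ ((a i).append (b W)))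

/-- `T` is NIP: no positive formula `φ(x;y)`, with `x` and `y` finite tuples of variables, has the
independence property. -/
def Theory.NIP (T : Theory L) : Prop :=
  ∀ {X Y : Type u} [Finite X] [Finite Y] (σ : X → L.Srt) (τ : Y → L.Srt)
    (φ : PosForm L (Sum.elim σ τ)), ¬ T.HasIP φ

/-! ### Hyperimaginary sorts -/

/-- A set of positive formulas (without parameters) `E(x, x')` in two copies of a, possibly
infinite, tuple of sorted variables `x = (v : Idx)`. -/
structure BinaryType (L : Signature.{u}) where
  Idx : Type u
  srt : Idx → L.Srt
  forms : Set (PosForm L (Sum.elim srt srt))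

/-- The relation defined by `E(x, x')` on tuples of `U`. -/
def BinaryType.Rel (E : BinaryType L) (U : Struc L) (a b : Tuple U E.srt) : Prop :=
  ∀ φ ∈ E.forms, Sat U φ (a.append b)

section Heq

variable {ι : Type u} (E : ι → BinaryType L)

/-- The index set of the tuple of home-sort variables corresponding to a variable whose sort is a
home sort (one variable) or a hyperimaginary sort. -/
def RepIdx : L.Srt ⊕ ι → Type u
  | .inl _ => PUnit
  | .inr i => (E i).Idx

/-- The sorts of the home-sort variables corresponding to a variable of a given sort. -/
def repSrt : (s : L.Srt ⊕ ι) → RepIdx E s → L.Srt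
  | .inl s, _ => s
  | .inr i, v => (E i).srt v

/-- The home-sort variables corresponding to a finite tuple of variables. -/
def repCtx {n : ℕ} (d : Fin n → L.Srt ⊕ ι) : ((k : Fin n) × RepIdx E (d k)) → L.Srt :=
  fun p => repSrt E (d p.1) p.2

/-- The hyperimaginary signature: `L` on the home sorts, a new sort for each `E i`, and a relation
symbol `R_φ` on each finite product of (home or hyperimaginary) sorts for each positive `L`-formula
`φ` in the corresponding home-sort variables. -/
def heqSignature : Signature.{u} where
  Srt := L.Srt ⊕ ι
  Fn := L.Fn
  fnArity := L.fnArity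
  fnDom f k := .inl (L.fnDom f k)
  fnCod f := .inl (L.fnCod f)
  Rel := L.Rel ⊕ ((n : ℕ) × (d : Fin n → L.Srt ⊕ ι) × PosForm L (repCtx E d))
  relArity
    | .inl R => L.relArity R
    | .inr r => r.1
  relDom
    | .inl R => fun k => .inl (L.relDom R k)
    | .inr r => r.2.1

variable (U : Struc L) (hE : ∀ i, Equivalence ((E i).Rel U))

/-- The home sorts are those of `U`; the hyperimaginary sort of `E i` is the set of tuples of `U`
modulo `E i`. -/
def heqCarrier : L.Srt ⊕ ι → Type u
  | .inl s => U.carrier s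
  | .inr i => Quotient (⟨(E i).Rel U, hE i⟩ : Setoid (Tuple U (E i).srt))

/-- The tuple `a` of elements of home sorts represents the element `c`. -/
def Represents : {s : L.Srt ⊕ ι} → Tuple U (repSrt E s) → heqCarrier E U hE s → Prop
  | .inl _, a, c => a PUnit.unit = c
  | .inr i, a, c => Quotient.mk (⟨(E i).Rel U, hE i⟩ : Setoid (Tuple U (E i).srt)) a = c

/-- The structure `U^heq`: `R_φ(c₁, …, cₙ)` holds if there are tuples `aₖ` representing `cₖ` with
`U ⊨ φ(a₁, …, aₙ)`. -/
def heqStruc : Struc (heqSignature E) where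
  carrier := heqCarrier E U hE
  fn f a := U.fn f a
  rel
    | .inl R => fun c => U.rel R c
    | .inr r => fun c => ∃ a : ∀ k, Tuple U (repSrt E (r.2.1 k)),
        (∀ k, Represents E U hE (a k) (c k)) ∧ Sat U r.2.2 (fun p => a p.1 p.2)

/-- The positive theory `T^heq`: all h-inductive sentences true in `U^heq`, for `U` a monster model
of `T`. -/
def heqTheory : Theory (heqSignature E) :=
  {θ | θ.True (heqStruc E U hE)}

end Heq

end PosLogic

open PosLogic

/-! Suppose `φ` has the independence property in `T^heq`, witnessed by `ψ` in some model. Shattering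
an `n`-element set is a positive sentence, and its negation is h-inductive; as `T^heq` contains
every h-inductive sentence true in `U^heq`, each finite shattering already occurs in `U^heq`
(`shatters_of_forall_hSentence`). Pulled back to representatives, `φ` and `ψ` become disjoint
conditions on tuples of `U`. They need not be positive formulas, since equality of classes is an
infinite conjunction and representatives may be infinite tuples, but saturation makes them
type-definable (`typeDefinable_holds_heq`). Compactness separates them by positive formulas `φ₀`,
`ψ₀` inconsistent in `U` (`Theory.IsMonster.exists_finite_conj_inconsistent`). These mention
finitely many variables, and enlarging the conditions preserves shattering. Joint continuation turns
inconsistency in `U` into inconsistency modulo `T` (`Theory.IsMonster.contradictory`), and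
saturation joins the finite shatterings into an infinite one (`Theory.IsMonster.hasIP_of_shatters`),
contradicting NIP of `T`. -/

namespace PosLogic

universe w

/-! ### Substitution, quantification and finite support of positive formulas -/

section Formulas

variable {L : Signature.{u}} {V W : Type u} {σ : V → L.Srt} {τ : W → L.Srt}

/-- Simultaneous substitution of terms for free and bound variables. -/
def Term.subst {Γ Δ : List L.Srt} (f : ∀ v, Term L τ Δ (σ v)) (g : ∀ k, Term L τ Δ (Γ.get k)) :
    {s : L.Srt} → Term L σ Γ s → Term L τ Δ s
  | _, .fvar v => f v
  | _, .bvar k => g k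
  | _, .app h args => .app h fun k => (args k).subst f g

theorem Term.val_subst {Γ Δ : List L.Srt} (f : ∀ v, Term L τ Δ (σ v))
    (g : ∀ k, Term L τ Δ (Γ.get k)) (A : Struc L) (a : Tuple A τ) (e : Tuple A Δ.get)
    {s : L.Srt} (t : Term L σ Γ s) :
    (t.subst f g).val A a e =
      t.val A (fun v => (f v).val A a e) (fun k => (g k).val A a e) := by
  induction t with
  | fvar v => rfl
  | bvar k => rfl
  | app h args ih => simp only [Term.subst, Term.val, ih]

/-- Weakening of a term by one bound variable. -/
def Term.lift {Γ : List L.Srt} (s₀ : L.Srt) {s : L.Srt} (t : Term L σ Γ s) :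
    Term L σ (s₀ :: Γ) s :=
  t.subst .fvar (fun k => .bvar (Γ := s₀ :: Γ) k.succ)

theorem Term.val_lift {Γ : List L.Srt} (A : Struc L) (a : Tuple A σ) {s₀ : L.Srt}
    (x : A.carrier s₀) (e : Tuple A Γ.get) {s : L.Srt} (t : Term L σ Γ s) :
    (t.lift s₀).val A a (Fin.cons (α := fun k => A.carrier ((s₀ :: Γ).get k)) x e) =
      t.val A a e := by
  unfold Term.lift
  rw [Term.val_subst]
  rfl

/-- Simultaneous substitution of terms for free and bound variables of a positive formula. -/
def BForm.subst : {Γ : List L.Srt} → BForm L σ Γ → {Δ : List L.Srt} →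
    (∀ v, Term L τ Δ (σ v)) → (∀ k, Term L τ Δ (Γ.get k)) → BForm L τ Δ
  | _, .eq t₁ t₂, _, f, g => .eq (t₁.subst f g) (t₂.subst f g)
  | _, .rel R args, _, f, g => .rel R fun k => (args k).subst f g
  | _, .top, _, _, _ => .top
  | _, .bot, _, _, _ => .bot
  | _, .and φ ψ, _, f, g => .and (φ.subst f g) (ψ.subst f g)
  | _, .or φ ψ, _, f, g => .or (φ.subst f g) (ψ.subst f g)
  | Γ, .ex s φ, Δ, f, g => .ex s (φ.subst (fun v => (f v).lift s)
      (Fin.cons (α := fun k => Term L τ (s :: Δ) ((s :: Γ).get k))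
        (.bvar (Γ := s :: Δ) 0) (fun k => (g k).lift s)))

theorem BForm.holds_subst (A : Struc L) (a : Tuple A τ) {Γ : List L.Srt} (φ : BForm L σ Γ)
    {Δ : List L.Srt} (f : ∀ v, Term L τ Δ (σ v)) (g : ∀ k, Term L τ Δ (Γ.get k))
    (e : Tuple A Δ.get) :
    (φ.subst f g).Holds A a e ↔
      φ.Holds A (fun v => (f v).val A a e) (fun k => (g k).val A a e) := by
  induction φ generalizing Δ with
  | eq t₁ t₂ => simp only [BForm.subst, BForm.Holds, Term.val_subst]
  | rel R args => simp only [BForm.subst, BForm.Holds, Term.val_subst]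
  | top => rfl
  | bot => rfl
  | and φ ψ ih₁ ih₂ => simp only [BForm.subst, BForm.Holds, ih₁, ih₂]
  | or φ ψ ih₁ ih₂ => simp only [BForm.subst, BForm.Holds, ih₁, ih₂]
  | ex s φ ih =>
    simp only [BForm.subst, BForm.Holds, ih, Term.val_lift]
    refine exists_congr fun x => ?_
    refine iff_of_eq (congrArg (φ.Holds A _) (funext fun k => ?_))
    refine Fin.cases ?_ (fun k => ?_) k
    · rfl
    · exact Term.val_lift A a x e (g k)

/-- Substitution of terms for the variables of a positive formula. -/
def BForm.inst (φ : PosForm L σ) (f : ∀ v, Term L τ [] (σ v)) : PosForm L τ :=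
  φ.subst f (fun k => k.elim0)

theorem sat_inst (A : Struc L) (φ : PosForm L σ) (f : ∀ v, Term L τ [] (σ v)) (a : Tuple A τ) :
    Sat A (φ.inst f) a ↔ Sat A φ (fun v => (f v).val (Γ := []) A a (fun k => k.elim0)) := by
  unfold Sat BForm.inst
  rw [BForm.holds_subst]
  exact iff_of_eq (congrArg (φ.Holds A _) (funext fun k => k.elim0))

theorem Hom.map_val {A B : Struc L} (h : Hom A B) (a : Tuple A σ) {Γ : List L.Srt}
    (e : Tuple A Γ.get) {s : L.Srt} (t : Term L σ Γ s) :
    h.map _ (t.val A a e) = t.val B (fun v => h.map _ (a v)) (fun k => h.map _ (e k)) := by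
  induction t with
  | fvar v => rfl
  | bvar k => rfl
  | app f args ih => simp only [Term.val, h.map_fn, ih]

theorem Hom.map_holds {A B : Struc L} (h : Hom A B) (a : Tuple A σ) {Γ : List L.Srt}
    (φ : BForm L σ Γ) (e : Tuple A Γ.get) (H : φ.Holds A a e) :
    φ.Holds B (fun v => h.map _ (a v)) (fun k => h.map _ (e k)) := by
  induction φ with
  | eq t₁ t₂ =>
    simp only [BForm.Holds] at H ⊢
    rw [← h.map_val, ← h.map_val, H]
  | rel R args =>
    simp only [BForm.Holds] at H ⊢
    simpa only [h.map_val] using h.map_rel R _ H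
  | top => trivial
  | bot => exact H
  | and φ ψ ih₁ ih₂ => exact ⟨ih₁ e H.1, ih₂ e H.2⟩
  | or φ ψ ih₁ ih₂ => exact H.imp (ih₁ e) (ih₂ e)
  | ex s φ ih =>
    obtain ⟨x, hx⟩ := H
    refine ⟨h.map _ x, ?_⟩
    refine cast (congrArg (φ.Holds B _) (funext fun k => ?_)) (ih _ hx)
    exact Fin.cases rfl (fun k => rfl) k

theorem Hom.map_sat {A B : Struc L} (h : Hom A B) (φ : PosForm L σ) (a : Tuple A σ)
    (H : Sat A φ a) : Sat B φ (fun v => h.map _ (a v)) :=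
  cast (congrArg (φ.Holds B _) (funext fun k => k.elim0)) (h.map_holds a φ _ H)

theorem exists_conj {ι : Type*} [Finite ι] (φ : ι → PosForm L σ) :
    ∃ χ : PosForm L σ, ∀ (A : Struc L) (a : Tuple A σ), Sat A χ a ↔ ∀ i, Sat A (φ i) a := by
  have key : ∀ l : List ι, ∃ χ : PosForm L σ, ∀ (A : Struc L) (a : Tuple A σ),
      Sat A χ a ↔ ∀ i ∈ l, Sat A (φ i) a := by
    intro l
    induction l with
    | nil => exact ⟨.top, fun A a => by simp [Sat, BForm.Holds]⟩
    | cons i l ih =>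
      obtain ⟨χ, hχ⟩ := ih
      refine ⟨.and (φ i) χ, fun A a => ?_⟩
      rw [List.forall_mem_cons, ← hχ]
      rfl
  have := Fintype.ofFinite ι
  obtain ⟨χ, hχ⟩ := key Finset.univ.toList
  exact ⟨χ, fun A a => by simp [hχ]⟩

theorem exists_ex_closure {Γ : List L.Srt} (φ : BForm L σ Γ) :
    ∃ χ : PosForm L σ, ∀ (A : Struc L) (a : Tuple A σ),
      Sat A χ a ↔ ∃ e, φ.Holds A a e := by
  induction Γ with
  | nil =>
    refine ⟨φ, fun A a => ⟨fun h => ⟨_, h⟩, fun ⟨e, h⟩ => ?_⟩⟩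
    have : e = fun k => k.elim0 := funext fun k => k.elim0
    rw [this] at h
    exact h
  | cons s Γ ih =>
    obtain ⟨χ, hχ⟩ := ih (.ex s φ)
    refine ⟨χ, fun A a => (hχ A a).trans ⟨fun ⟨e, x, h⟩ => ⟨_, h⟩, fun ⟨e, h⟩ => ?_⟩⟩
    refine ⟨fun k => e k.succ, e 0, ?_⟩
    refine cast (congrArg (φ.Holds A _) (funext fun k => ?_)) h
    exact Fin.cases rfl (fun k => rfl) k

/-- Translates named variables into bound ones. The terms are fixed before the structure and the
tuple, so they can be substituted into a formula that is then closed under quantifiers. If `l` has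
repetitions, the first occurrence is used. -/
theorem exists_boundTerms (σ : V → L.Srt) (τ : W → L.Srt) (l : List W) :
    ∃ f : ∀ w ∈ l, Term L σ (l.map τ) (τ w), ∀ (A : Struc L) (b : Tuple A τ),
      ∃ e : Tuple A (l.map τ).get, ∀ (a : Tuple A σ) (w : W) (h : w ∈ l),
        (f w h).val A a e = b w := by
  classical
  induction l with
  | nil => exact ⟨fun w h => absurd h (by simp), fun A b => ⟨fun k => k.elim0, fun a w h =>
      absurd h (by simp)⟩⟩
  | cons w₀ l ih =>
    obtain ⟨f, hf⟩ := ih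
    refine ⟨fun w h => if hw : w₀ = w then
        hw ▸ (Term.bvar (Γ := τ w₀ :: l.map τ) 0 : Term L σ (τ w₀ :: l.map τ) (τ w₀))
      else (f w ((List.mem_cons.1 h).resolve_left (Ne.symm hw))).lift (τ w₀), fun A b => ?_⟩
    obtain ⟨e, he⟩ := hf A b
    refine ⟨Fin.cons (α := fun k => A.carrier ((τ w₀ :: l.map τ).get k)) (b w₀) e,
      fun a w h => ?_⟩
    by_cases hw : w₀ = w
    · subst hw
      simp only [↓reduceDIte]
      rfl
    · simp only [dif_neg hw]
      exact (Term.val_lift A a (b w₀) e _).trans (he a w _)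

/-- Finiteness of `W` makes `χ` uniform in `A`, even when some sorts are empty. -/
theorem exists_ex [Finite W] (φ : PosForm L (Sum.elim σ τ)) :
    ∃ χ : PosForm L σ, ∀ (A : Struc L) (a : Tuple A σ),
      Sat A χ a ↔ ∃ b : Tuple A τ, Sat A φ (a.append b) := by
  have := Fintype.ofFinite W
  obtain ⟨f, hf⟩ := exists_boundTerms σ τ (Finset.univ : Finset W).toList
  have hmem : ∀ w : W, w ∈ (Finset.univ : Finset W).toList := by simp
  let g : ∀ v, Term L σ ((Finset.univ : Finset W).toList.map τ) (Sum.elim σ τ v) := fun v =>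
    match v with
    | .inl v => .fvar v
    | .inr w => f w (hmem w)
  obtain ⟨χ, hχ⟩ := exists_ex_closure (φ.subst g (fun k => k.elim0))
  refine ⟨χ, fun A a => (hχ A a).trans ?_⟩
  have key : ∀ e, (φ.subst g (fun k => k.elim0)).Holds A a e ↔
      Sat A φ (a.append fun w => (f w (hmem w)).val A a e) := by
    intro e
    rw [BForm.holds_subst]
    have h₁ : (fun v => (g v).val A a e) = a.append fun w => (f w (hmem w)).val A a e := by
      funext v
      cases v <;> rfl
    rw [h₁]
    exact iff_of_eq (congrArg (φ.Holds A _) (funext fun k => k.elim0))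
  simp only [key]
  constructor
  · rintro ⟨e, h⟩
    exact ⟨_, h⟩
  · rintro ⟨b, h⟩
    obtain ⟨e, he⟩ := hf A b
    refine ⟨e, ?_⟩
    simpa only [he] using h

/-- Allowing every `G ⊇ F`, rather than `F` alone, lets the induction restrict all subterms to one
common set of variables. -/
theorem Term.exists_restrict {Γ : List L.Srt} {s : L.Srt} (t : Term L σ Γ s) :
    ∃ F : Set V, F.Finite ∧ ∀ G : Set V, F ⊆ G → ∃ t' : Term L (fun v : G => σ v) Γ s,
      ∀ (A : Struc L) (a : Tuple A σ) (e : Tuple A Γ.get),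
        t'.val (σ := fun v : G => σ v) A (fun v => a v) e = t.val A a e := by
  induction t with
  | fvar v =>
    exact ⟨{v}, Set.finite_singleton v, fun G hG =>
      ⟨.fvar (σ := fun v : G => σ v) ⟨v, hG rfl⟩, fun A a e => rfl⟩⟩
  | bvar k => exact ⟨∅, Set.finite_empty, fun G hG => ⟨.bvar k, fun A a e => rfl⟩⟩
  | app f args ih =>
    choose F hF h using ih
    refine ⟨⋃ k, F k, Set.finite_iUnion hF, fun G hG => ?_⟩
    choose t' ht' using fun k => h k G ((Set.subset_iUnion F k).trans hG)
    exact ⟨.app f t', fun A a e => by simp only [Term.val, ht']⟩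

theorem BForm.exists_restrict {Γ : List L.Srt} (φ : BForm L σ Γ) :
    ∃ F : Set V, F.Finite ∧ ∀ G : Set V, F ⊆ G → ∃ φ' : BForm L (fun v : G => σ v) Γ,
      ∀ (A : Struc L) (a : Tuple A σ) (e : Tuple A Γ.get),
        φ'.Holds (σ := fun v : G => σ v) A (fun v => a v) e ↔ φ.Holds A a e := by
  induction φ with
  | eq t₁ t₂ =>
    obtain ⟨F₁, hF₁, h₁⟩ := t₁.exists_restrict
    obtain ⟨F₂, hF₂, h₂⟩ := t₂.exists_restrict
    refine ⟨F₁ ∪ F₂, hF₁.union hF₂, fun G hG => ?_⟩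
    obtain ⟨t₁', ht₁⟩ := h₁ G (Set.subset_union_left.trans hG)
    obtain ⟨t₂', ht₂⟩ := h₂ G (Set.subset_union_right.trans hG)
    exact ⟨.eq t₁' t₂', fun A a e => by simp only [BForm.Holds, ht₁, ht₂]⟩
  | rel R args =>
    choose F hF h using fun k => (args k).exists_restrict
    refine ⟨⋃ k, F k, Set.finite_iUnion hF, fun G hG => ?_⟩
    choose t' ht' using fun k => h k G ((Set.subset_iUnion F k).trans hG)
    exact ⟨.rel R t', fun A a e => by simp only [BForm.Holds, ht']⟩
  | top => exact ⟨∅, Set.finite_empty, fun G hG => ⟨.top, fun A a e => Iff.rfl⟩⟩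
  | bot => exact ⟨∅, Set.finite_empty, fun G hG => ⟨.bot, fun A a e => Iff.rfl⟩⟩
  | and φ ψ ih₁ ih₂ =>
    obtain ⟨F₁, hF₁, h₁⟩ := ih₁
    obtain ⟨F₂, hF₂, h₂⟩ := ih₂
    refine ⟨F₁ ∪ F₂, hF₁.union hF₂, fun G hG => ?_⟩
    obtain ⟨φ', hφ⟩ := h₁ G (Set.subset_union_left.trans hG)
    obtain ⟨ψ', hψ⟩ := h₂ G (Set.subset_union_right.trans hG)
    exact ⟨.and φ' ψ', fun A a e => by simp only [BForm.Holds, hφ, hψ]⟩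
  | or φ ψ ih₁ ih₂ =>
    obtain ⟨F₁, hF₁, h₁⟩ := ih₁
    obtain ⟨F₂, hF₂, h₂⟩ := ih₂
    refine ⟨F₁ ∪ F₂, hF₁.union hF₂, fun G hG => ?_⟩
    obtain ⟨φ', hφ⟩ := h₁ G (Set.subset_union_left.trans hG)
    obtain ⟨ψ', hψ⟩ := h₂ G (Set.subset_union_right.trans hG)
    exact ⟨.or φ' ψ', fun A a e => by simp only [BForm.Holds, hφ, hψ]⟩
  | ex s φ ih =>
    obtain ⟨F, hF, h⟩ := ih
    refine ⟨F, hF, fun G hG => ?_⟩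
    obtain ⟨φ', hφ⟩ := h G hG
    exact ⟨.ex s φ', fun A a e => by simp only [BForm.Holds, hφ]⟩

/-- A positive formula in two tuples of variables mentions only finitely many of them. -/
theorem exists_restrict_sum (φ : PosForm L (Sum.elim σ τ)) :
    ∃ F : Set V, ∃ G : Set W, F.Finite ∧ G.Finite ∧ ∀ F' : Set V, F ⊆ F' → ∀ G' : Set W, G ⊆ G' →
      ∃ φ' : PosForm L (Sum.elim (fun v : F' => σ v) (fun w : G' => τ w)),
        ∀ (A : Struc L) (a : Tuple A σ) (b : Tuple A τ),
          Sat A φ' (Tuple.append (σ := fun v : F' => σ v) (τ := fun w : G' => τ w)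
            (fun v => a v) (fun w => b w)) ↔ Sat A φ (a.append b) := by
  obtain ⟨F, hF, h⟩ := BForm.exists_restrict φ
  refine ⟨Sum.inl ⁻¹' F, Sum.inr ⁻¹' F, hF.preimage Sum.inl_injective.injOn,
    hF.preimage Sum.inr_injective.injOn, fun F' hF' G' hG' => ?_⟩
  obtain ⟨φ', hφ'⟩ := h F subset_rfl
  let f : ∀ v : F, Term L (Sum.elim (fun v : F' => σ v) (fun w : G' => τ w)) []
      (Sum.elim σ τ v.1) := fun v => match v with
    | ⟨.inl v, hv⟩ => .fvar (σ := Sum.elim (fun v : F' => σ v) (fun w : G' => τ w))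
        (Sum.inl ⟨v, hF' hv⟩)
    | ⟨.inr w, hw⟩ => .fvar (σ := Sum.elim (fun v : F' => σ v) (fun w : G' => τ w))
        (Sum.inr ⟨w, hG' hw⟩)
  refine ⟨BForm.inst φ' f, fun A a b => ?_⟩
  rw [sat_inst]
  refine Iff.trans ?_ (hφ' A (a.append b) _)
  refine iff_of_eq (congrArg (Sat A φ') (funext fun v => ?_))
  rcases v with ⟨v | w, hv⟩ <;> rfl

end Formulas

/-! ### Counting positive formulas -/

section Cardinality

variable {L : Signature.{u}} {V : Type u} {σ : V → L.Srt}

/-- The node labels of the syntax trees of terms and positive formulas. -/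
abbrev SyntaxLabel (L : Signature.{u}) (V : Type u) : Type u :=
  V ⊕ ℕ ⊕ L.Fn ⊕ L.Rel ⊕ L.Srt ⊕ L.Srt ⊕ Bool ⊕ Bool

/-- The branching of the syntax trees of terms and positive formulas. -/
def SyntaxLabel.Branch : SyntaxLabel L V → Type
  | .inl _ => Empty
  | .inr (.inl _) => Empty
  | .inr (.inr (.inl f)) => Fin (L.fnArity f)
  | .inr (.inr (.inr (.inl R))) => Fin (L.relArity R)
  | .inr (.inr (.inr (.inr (.inl _)))) => Bool
  | .inr (.inr (.inr (.inr (.inr (.inl _))))) => Unit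
  | .inr (.inr (.inr (.inr (.inr (.inr (.inl _)))))) => Empty
  | .inr (.inr (.inr (.inr (.inr (.inr (.inr _)))))) => Bool

instance SyntaxLabel.finite_branch (x : SyntaxLabel L V) : Finite x.Branch := by
  rcases x with _ | _ | _ | _ | _ | _ | _ | _ <;> unfold SyntaxLabel.Branch <;> infer_instance

/-- Syntax trees. -/
abbrev SyntaxTree (L : Signature.{u}) (V : Type u) : Type u :=
  WType (SyntaxLabel.Branch (L := L) (V := V))

/-- The syntax tree of a term. -/
def Term.tree {Γ : List L.Srt} : {s : L.Srt} → Term L σ Γ s → SyntaxTree L V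
  | _, .fvar v => .mk (.inl v) Empty.elim
  | _, .bvar k => .mk (.inr (.inl k)) Empty.elim
  | _, .app f args => .mk (.inr (.inr (.inl f))) fun k => (args k).tree

/-- The syntax tree of a positive formula. -/
def BForm.tree : {Γ : List L.Srt} → BForm L σ Γ → SyntaxTree L V
  | _, .eq (s := s) t₁ t₂ => .mk (.inr (.inr (.inr (.inr (.inl s)))))
      fun b : Bool => bif b then t₁.tree else t₂.tree
  | _, .rel R args => .mk (.inr (.inr (.inr (.inl R)))) fun k => (args k).tree
  | _, .top => .mk (.inr (.inr (.inr (.inr (.inr (.inr (.inl true))))))) Empty.elim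
  | _, .bot => .mk (.inr (.inr (.inr (.inr (.inr (.inr (.inl false))))))) Empty.elim
  | _, .and φ ψ => .mk (.inr (.inr (.inr (.inr (.inr (.inr (.inr true)))))))
      fun b : Bool => bif b then φ.tree else ψ.tree
  | _, .or φ ψ => .mk (.inr (.inr (.inr (.inr (.inr (.inr (.inr false)))))))
      fun b : Bool => bif b then φ.tree else ψ.tree
  | _, .ex s φ => .mk (.inr (.inr (.inr (.inr (.inr (.inl s)))))) fun _ => φ.tree

/-- A tree does not carry the sort of its term as an index, so the sort has to be recovered together
with the term. -/
theorem Term.sigma_eq_of_tree_eq {Γ : List L.Srt} {s s' : L.Srt} (t : Term L σ Γ s)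
    (t' : Term L σ Γ s') (h : t.tree = t'.tree) :
    (⟨s, t⟩ : (s : L.Srt) × Term L σ Γ s) = ⟨s', t'⟩ := by
  induction t generalizing s' with
  | fvar v =>
    cases t' <;> obtain ⟨h₀, h⟩ := WType.mk.inj h <;>
      simp only [Sum.inl.injEq, Sum.inr.injEq, reduceCtorEq] at h₀
    obtain rfl := h₀
    rfl
  | bvar k =>
    cases t' <;> obtain ⟨h₀, h⟩ := WType.mk.inj h <;>
      simp only [Sum.inl.injEq, Sum.inr.injEq, reduceCtorEq] at h₀
    obtain rfl := Fin.ext h₀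
    rfl
  | app f args ih =>
    cases t' <;> obtain ⟨h₀, h⟩ := WType.mk.inj h <;>
      simp only [Sum.inl.injEq, Sum.inr.injEq, reduceCtorEq] at h₀
    obtain rfl := h₀
    have h := congrFun (eq_of_heq h)
    congr
    funext k
    exact eq_of_heq (Sigma.mk.inj (ih k _ (h k))).2

theorem Term.tree_injective {Γ : List L.Srt} {s : L.Srt} :
    Function.Injective (Term.tree : Term L σ Γ s → SyntaxTree L V) := fun t t' h =>
  eq_of_heq (Sigma.mk.inj (t.sigma_eq_of_tree_eq t' h)).2

theorem BForm.tree_injective {Γ : List L.Srt} :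
    Function.Injective (BForm.tree : BForm L σ Γ → SyntaxTree L V) := by
  intro φ ψ h
  induction φ with
  | eq t₁ t₂ =>
    cases ψ <;> obtain ⟨h₀, h⟩ := WType.mk.inj h <;>
      simp only [Sum.inl.injEq, Sum.inr.injEq, reduceCtorEq] at h₀
    obtain rfl := h₀
    have h := congrFun (eq_of_heq h)
    rw [Term.tree_injective (h true), Term.tree_injective (h false)]
  | rel R args =>
    cases ψ <;> obtain ⟨h₀, h⟩ := WType.mk.inj h <;>
      simp only [Sum.inl.injEq, Sum.inr.injEq, reduceCtorEq] at h₀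
    obtain rfl := h₀
    have h := congrFun (eq_of_heq h)
    congr
    funext k
    exact Term.tree_injective (h k)
  | top =>
    cases ψ <;> obtain ⟨h₀, h⟩ := WType.mk.inj h <;>
      simp only [Sum.inl.injEq, Sum.inr.injEq, reduceCtorEq] at h₀
    rfl
  | bot =>
    cases ψ <;> obtain ⟨h₀, h⟩ := WType.mk.inj h <;>
      simp only [Sum.inl.injEq, Sum.inr.injEq, reduceCtorEq] at h₀
    rfl
  | and φ ψ ih₁ ih₂ =>
    cases ‹BForm L σ _› <;> obtain ⟨h₀, h⟩ := WType.mk.inj h <;>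
      simp only [Sum.inl.injEq, Sum.inr.injEq, reduceCtorEq] at h₀
    have h := congrFun (eq_of_heq h)
    rw [ih₁ (h true), ih₂ (h false)]
  | or φ ψ ih₁ ih₂ =>
    cases ‹BForm L σ _› <;> obtain ⟨h₀, h⟩ := WType.mk.inj h <;>
      simp only [Sum.inl.injEq, Sum.inr.injEq, reduceCtorEq] at h₀
    have h := congrFun (eq_of_heq h)
    rw [ih₁ (h true), ih₂ (h false)]
  | ex s φ ih =>
    cases ψ <;> obtain ⟨h₀, h⟩ := WType.mk.inj h <;>
      simp only [Sum.inl.injEq, Sum.inr.injEq, reduceCtorEq] at h₀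
    obtain rfl := h₀
    rw [ih (congrFun (eq_of_heq h) ())]

open Cardinal in
-- Finitely branching trees number at most the maximum of `ℵ₀` and the number of labels, and the
-- labels are a finite sum of sets smaller than `κ`. Regularity of `κ` is not needed.
theorem mk_posForm_lt {κ : Cardinal.{u}} (hκ : ℵ₀ < κ) (hL : L.card < κ) (hV : #V < κ)
    (σ : V → L.Srt) : #(PosForm L σ) < κ := by
  refine (mk_le_of_injective (BForm.tree_injective (L := L) (σ := σ))).trans_lt ?_
  refine WType.cardinalMk_le_max_aleph0_of_finite'.trans_lt (max_lt ?_ hκ)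
  have hS : #L.Srt < κ := (le_self_add.trans le_self_add).trans_lt hL
  have hF : #L.Fn < κ := (le_add_self.trans le_self_add).trans_lt hL
  have hR : #L.Rel < κ := le_add_self.trans_lt hL
  have h2 : (2 : Cardinal.{u}) < κ := (natCast_lt_aleph0 (n := 2)).trans hκ
  simp only [mk_sum, mk_bool, lift_id, lift_uzero, lift_aleph0, lift_ofNat, mk_eq_aleph0, lift_add]
  have := hκ.le
  repeat' first | assumption | apply add_lt_of_lt this
  
end Cardinality

/-! ### Saturation and type-definable sets in the monster model -/

section Saturation

open Cardinal

variable {L : Signature.{u}} {V W : Type u} {σ : V → L.Srt} {τ : W → L.Srt}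
  {T : Theory L} {κ : Cardinal.{u}} {U : Struc L}

/-- Each variable of `σ` is replaced by the parameter naming its value. Only the set of formulas has
to be small, not the tuple `a`. -/
theorem Theory.IsMonster.exists_realization (hU : T.IsMonster κ U) (a : Tuple U σ)
    {S : Set (PosForm L (Sum.elim σ τ))} (hS : #S < κ)
    (hfin : ∀ F ⊆ S, F.Finite → ∃ b : Tuple U τ, ∀ φ ∈ F, Sat U φ (a.append b)) :
    ∃ b : Tuple U τ, ∀ φ ∈ S, Sat U φ (a.append b) := by
  let f : ∀ v, Term L (Sum.elim τ (fun p : (s : L.Srt) × U.carrier s => p.1)) []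
      (Sum.elim σ τ v) := fun v => match v with
    | .inl v => .fvar (σ := Sum.elim τ (fun p : (s : L.Srt) × U.carrier s => p.1))
        (.inr ⟨σ v, a v⟩)
    | .inr w => .fvar (σ := Sum.elim τ (fun p : (s : L.Srt) × U.carrier s => p.1)) (.inl w)
  have key : ∀ (φ : PosForm L (Sum.elim σ τ)) (b : Tuple U τ),
      Sat U (φ.inst f) (Tuple.append b (fun p : (s : L.Srt) × U.carrier s => p.2)) ↔
        Sat U φ (a.append b) := by
    intro φ b
    rw [sat_inst]
    refine iff_of_eq (congrArg (Sat U φ) (funext fun v => ?_))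
    cases v <;> rfl
  obtain ⟨b, hb⟩ := hU.saturated τ ((fun φ => BForm.inst φ f) '' S) (mk_image_le.trans_lt hS)
    (fun F hF hFfin => by
      obtain ⟨F', hF', hfin', rfl⟩ := (Set.exists_subset_image_finite_and
        (p := fun t => t = F)).1 ⟨F, hF, hFfin, rfl⟩
      obtain ⟨b, hb⟩ := hfin F' hF' hfin'
      refine ⟨b, ?_⟩
      rintro _ ⟨φ, hφ, rfl⟩
      exact (key φ b).2 (hb φ hφ))
  exact ⟨b, fun φ hφ => (key φ b).1 (hb _ ⟨φ, hφ, rfl⟩)⟩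

theorem Theory.IsMonster.exists_realization_seq (hU : T.IsMonster κ U) (hκ : ℵ₀ < κ)
    (a : Tuple U σ) (φ : ℕ → PosForm L (Sum.elim σ τ))
    (h : ∀ n, ∃ b : Tuple U τ, ∀ i < n, Sat U (φ i) (a.append b)) :
    ∃ b : Tuple U τ, ∀ i, Sat U (φ i) (a.append b) := by
  obtain ⟨b, hb⟩ := hU.exists_realization a (S := Set.range φ)
    (((le_aleph0_iff_set_countable).2 (Set.countable_range φ)).trans_lt hκ) (fun F hF hfin => by
      rw [← Set.image_univ] at hF
      obtain ⟨I, -, hI, rfl⟩ := (Set.exists_subset_image_finite_and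
        (p := fun t => t = F)).1 ⟨F, hF, hfin, rfl⟩
      obtain ⟨n, hn⟩ := hI.bddAbove
      obtain ⟨b, hb⟩ := h (n + 1)
      refine ⟨b, ?_⟩
      rintro _ ⟨i, hi, rfl⟩
      exact hb i (Nat.lt_succ_of_le (hn hi)))
  exact ⟨b, fun i => hb _ ⟨i, rfl⟩⟩

/-- Weakening of a positive formula by a first tuple of variables. -/
def BForm.weaken (σ : V → L.Srt) (φ : PosForm L τ) : PosForm L (Sum.elim σ τ) :=
  φ.inst fun w => .fvar (σ := Sum.elim σ τ) (.inr w)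

theorem sat_weaken {A : Struc L} (φ : PosForm L τ) (a : Tuple A σ) (b : Tuple A τ) :
    Sat A (BForm.weaken σ φ) (a.append b) ↔ Sat A φ b :=
  sat_inst A φ _ _

/-- Over a fixed structure, positive formulas are closed under quantification over an arbitrary
tuple of variables. -/
theorem exists_ex_of_struc (U : Struc L) (φ : PosForm L (Sum.elim σ τ)) :
    ∃ χ : PosForm L σ, ∀ a : Tuple U σ,
      Sat U χ a ↔ ∃ b : Tuple U τ, Sat U φ (a.append b) := by
  classical
  -- Variables not occurring in `φ` still demand inhabited sorts; whether these exist depends on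
  -- `U`, hence so does the choice of `χ`.
  by_cases hne : Nonempty (Tuple U τ)
  · obtain ⟨b₀⟩ := hne
    obtain ⟨F, G, -, hG, h⟩ := exists_restrict_sum φ
    obtain ⟨φ', hφ'⟩ := h F subset_rfl G subset_rfl
    have := hG.to_subtype
    obtain ⟨χ, hχ⟩ := exists_ex φ'
    refine ⟨BForm.inst χ (fun v : F => .fvar (σ := σ) v.1), fun a => ?_⟩
    rw [sat_inst]
    refine (hχ U (fun v : F => a v)).trans ⟨?_, ?_⟩
    · rintro ⟨b, hb⟩
      refine ⟨fun w => if h : w ∈ G then b ⟨w, h⟩ else b₀ w, (hφ' U _ _).1 ?_⟩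
      convert hb with w
      exact dif_pos w.2
    · rintro ⟨b, hb⟩
      exact ⟨_, (hφ' U a b).2 hb⟩
  · exact ⟨.bot, fun a => ⟨False.elim, fun ⟨b, _⟩ => hne ⟨b⟩⟩⟩

/-- A set of tuples of `U` defined by a set of positive formulas without parameters. -/
def TypeDefinable (U : Struc L) (P : Tuple U σ → Prop) : Prop :=
  ∃ S : Set (PosForm L σ), ∀ a, P a ↔ ∀ φ ∈ S, Sat U φ a

theorem typeDefinable_sat (φ : PosForm L σ) : TypeDefinable U (Sat U φ) :=
  ⟨{φ}, fun a => by simp⟩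

theorem TypeDefinable.of_iff {P Q : Tuple U σ → Prop} (hP : TypeDefinable U P)
    (h : ∀ a, Q a ↔ P a) : TypeDefinable U Q :=
  (funext fun a => propext (h a) : Q = P) ▸ hP

theorem TypeDefinable.forall {ι : Type*} {P : ι → Tuple U σ → Prop}
    (hP : ∀ i, TypeDefinable U (P i)) : TypeDefinable U (fun a => ∀ i, P i a) := by
  choose S hS using hP
  refine ⟨⋃ i, S i, fun a => ?_⟩
  simp only [hS, Set.mem_iUnion]
  exact ⟨fun h φ ⟨i, hi⟩ => h i φ hi, fun h i φ hi => h φ ⟨i, hi⟩⟩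

theorem TypeDefinable.and {P Q : Tuple U σ → Prop} (hP : TypeDefinable U P)
    (hQ : TypeDefinable U Q) : TypeDefinable U (fun a => P a ∧ Q a) := by
  obtain ⟨S, hS⟩ := hP
  obtain ⟨R, hR⟩ := hQ
  refine ⟨S ∪ R, fun a => ?_⟩
  simp only [hS, hR, Set.mem_union, or_imp, forall_and]

theorem TypeDefinable.or {P Q : Tuple U σ → Prop} (hP : TypeDefinable U P)
    (hQ : TypeDefinable U Q) : TypeDefinable U (fun a => P a ∨ Q a) := by
  obtain ⟨S, hS⟩ := hP
  obtain ⟨R, hR⟩ := hQ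
  refine ⟨Set.image2 BForm.or S R, fun a => ?_⟩
  simp only [hS, hR, Set.forall_mem_image2]
  constructor
  · rintro (h | h) φ hφ ψ hψ
    · exact Or.inl (h φ hφ)
    · exact Or.inr (h ψ hψ)
  · intro h
    by_contra! hc
    obtain ⟨⟨φ, hφ, h₁⟩, ψ, hψ, h₂⟩ := hc
    exact (h φ hφ ψ hψ).elim h₁ h₂

theorem TypeDefinable.inst {P : Tuple U σ → Prop} (hP : TypeDefinable U P)
    (f : ∀ v, Term L τ [] (σ v)) :
    TypeDefinable U (fun a : Tuple U τ =>
      P fun v => (f v).val (Γ := []) U a (fun k => k.elim0)) := by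
  obtain ⟨S, hS⟩ := hP
  refine ⟨(fun φ => BForm.inst φ f) '' S, fun a => ?_⟩
  simp only [hS, Set.forall_mem_image, sat_inst]

/-- The projection is defined by all positive formulas that hold on it. If `a` satisfies them, it
satisfies the projection of each finite conjunction from `S`, so saturation provides a single `b`
for all of `S`. -/
theorem TypeDefinable.exists (hU : T.IsMonster κ U) (hκ : #(PosForm L (Sum.elim σ τ)) < κ)
    {P : Tuple U (Sum.elim σ τ) → Prop} (hP : TypeDefinable U P) :
    TypeDefinable U (fun a : Tuple U σ => ∃ b : Tuple U τ, P (a.append b)) := by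
  obtain ⟨S, hS⟩ := hP
  refine ⟨{χ | ∀ a, (∃ b, P (Tuple.append a b)) → Sat U χ a}, fun a => ⟨fun h χ hχ => hχ a h,
    fun h => ?_⟩⟩
  simp only [hS] at h ⊢
  refine hU.exists_realization a ((mk_set_le S).trans_lt hκ) fun F hF hfin => ?_
  have := hfin.to_subtype
  obtain ⟨φ, hφ⟩ := exists_conj (fun i : F => i.1)
  obtain ⟨χ, hχ⟩ := exists_ex_of_struc U φ
  obtain ⟨b, hb⟩ := (hχ a).1 (h χ fun a' ⟨b, hb⟩ =>
    (hχ a').2 ⟨b, (hφ U _).2 fun i => hb i.1 (hF i.2)⟩)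
  exact ⟨b, fun ψ hψ => (hφ U _).1 hb ⟨ψ, hψ⟩⟩

end Saturation

/-! ### Pulling formulas of `U^heq` back to representatives -/

section Heq

open Cardinal

variable {L : Signature.{u}} {ι : Type u} (E : ι → BinaryType L)

/-- The sorts of the home-sort variables corresponding to a tuple of variables. -/
def repVars {V : Type*} (σ : V → L.Srt ⊕ ι) (p : (v : V) × RepIdx E (σ v)) : L.Srt :=
  repSrt E (σ p.1) p.2

theorem mk_repIdx_lt {κ : Cardinal.{u}} (hκ : ℵ₀ < κ) (hsmall : ∀ i, #(E i).Idx < κ)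
    (s : L.Srt ⊕ ι) : #(RepIdx E s) < κ := by
  rcases s with s | i
  · exact (mk_le_aleph0 (α := PUnit)).trans_lt hκ
  · exact hsmall i

/-- A finite family has a largest member, so one bound below `κ` serves for all. -/
theorem mk_sigma_lt {κ : Cardinal.{u}} (hκ : ℵ₀ < κ) {V : Type w} [Finite V]
    {I : V → Type u} (h : ∀ v, #(I v) < κ) : #((v : V) × I v) < lift.{w} κ := by
  obtain ⟨M, hM, hI⟩ : ∃ M < κ, ∀ v, #(I v) ≤ M := by
    rcases isEmpty_or_nonempty V with hV | hV
    · exact ⟨ℵ₀, hκ, fun v => hV.elim v⟩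
    · obtain ⟨v, hv⟩ := Finite.exists_max fun v => #(I v)
      exact ⟨_, h v, hv⟩
  have hκ' : ℵ₀ < lift.{w} κ := aleph0_lt_lift.2 hκ
  rw [mk_sigma]
  refine (sum_le_sum _ _ hI).trans_lt ?_
  rw [sum_const]
  exact mul_lt_of_lt hκ'.le ((lift_lt_aleph0.2 (lt_aleph0_of_finite V)).trans hκ') (lift_lt.2 hM)

variable (U : Struc L) (hE : ∀ i, Equivalence ((E i).Rel U))

/-- The element of a sort of `U^heq` represented by a tuple of `U`. -/
def heqClass : (s : L.Srt ⊕ ι) → Tuple U (repSrt E s) → heqCarrier E U hE s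
  | .inl _, a => a PUnit.unit
  | .inr i, a => Quotient.mk (⟨(E i).Rel U, hE i⟩ : Setoid (Tuple U (E i).srt)) a

theorem represents_iff {s : L.Srt ⊕ ι} (a : Tuple U (repSrt E s)) (c : heqCarrier E U hE s) :
    Represents E U hE a c ↔ heqClass E U hE s a = c := by
  cases s <;> rfl

theorem heqClass_surjective (s : L.Srt ⊕ ι) : Function.Surjective (heqClass E U hE s) := by
  intro c
  rcases s with s | i
  · exact ⟨fun _ => c, rfl⟩
  · exact Quotient.exists_rep c

/-- The tuple of elements of `U^heq` represented by a tuple of `U`. -/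
def heqTuple {V : Type*} {σ : V → L.Srt ⊕ ι} (a : Tuple U (repVars E σ)) :
    Tuple (heqStruc E U hE) (L := heqSignature E) σ :=
  fun v => heqClass E U hE (σ v) fun j => a ⟨v, j⟩

theorem heqTuple_surjective {V : Type*} (σ : V → L.Srt ⊕ ι) :
    Function.Surjective (heqTuple E U hE (σ := σ)) := by
  intro c
  choose a ha using fun v => heqClass_surjective E U hE (σ v) (c v)
  exact ⟨fun p => a p.1 p.2, funext ha⟩

theorem typeDefinable_heqClass_eq (s : L.Srt ⊕ ι) :
    TypeDefinable U (fun c : Tuple U (Sum.elim (repSrt E s) (repSrt E s)) =>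
      heqClass E U hE s (fun j => c (.inl j)) = heqClass E U hE s (fun j => c (.inr j))) := by
  rcases s with s | i
  · exact typeDefinable_sat (BForm.eq
      (.fvar (σ := Sum.elim (repSrt E (.inl s)) (repSrt E (.inl s))) (.inl PUnit.unit))
      (.fvar (σ := Sum.elim (repSrt E (.inl s)) (repSrt E (.inl s))) (.inr PUnit.unit)))
  · refine ⟨(E i).forms, fun c => Quotient.eq.trans (forall₂_congr fun φ _ =>
      iff_of_eq (congrArg (Sat U φ) (funext fun v => ?_)))⟩
    cases v <;> rfl

variable {V : Type u} {σ : V → L.Srt ⊕ ι}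

/-- Function symbols act only on home sorts, so a term of a hyperimaginary sort is a variable and
any other term is essentially an `L`-term. -/
theorem Term.exists_representatives {Γ : List (heqSignature E).Srt} {s : (heqSignature E).Srt}
    (t : Term (heqSignature E) σ Γ s) :
    ∃ f : ∀ j, Term L (Sum.elim (repVars E σ) (repVars E Γ.get)) [] (repSrt E s j),
      ∀ c : Tuple U (Sum.elim (repVars E σ) (repVars E Γ.get)),
        heqClass E U hE s (fun j => (f j).val (Γ := []) U c (fun k => k.elim0)) =
          t.val (heqStruc E U hE) (heqTuple E U hE fun p => c (.inl p))
            (heqTuple E U hE fun p => c (.inr p)) := by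
  induction t with
  | fvar v =>
    exact ⟨fun j => .fvar (σ := Sum.elim (repVars E σ) (repVars E Γ.get)) (.inl ⟨v, j⟩),
      fun c => rfl⟩
  | bvar k =>
    exact ⟨fun j => .fvar (σ := Sum.elim (repVars E σ) (repVars E Γ.get)) (.inr ⟨k, j⟩),
      fun c => rfl⟩
  | app h args ih =>
    choose f hf using ih
    refine ⟨fun _ => Term.app (L := L) h fun k => f k PUnit.unit, fun c => ?_⟩
    exact congrArg (U.fn h) (funext fun k => hf k c)

variable {T : Theory L} {κ : Cardinal.{u}}

/-- By induction on `φ`. The symbols `R_φ` and the quantifier both ask for representatives, possibly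
infinite tuples; these are the cases that need `TypeDefinable.exists`, hence the smallness
assumptions. -/
theorem typeDefinable_holds_heq (hU : T.IsMonster κ U) (hκ : ℵ₀ < κ) (hL : L.card < κ)
    (hsmall : ∀ i, #(E i).Idx < κ) [Finite V] {Γ : List (heqSignature E).Srt}
    (φ : BForm (heqSignature E) σ Γ) :
    TypeDefinable U (fun c : Tuple U (Sum.elim (repVars E σ) (repVars E Γ.get)) =>
      φ.Holds (heqStruc E U hE) (heqTuple E U hE fun p => c (.inl p))
        (heqTuple E U hE fun p => c (.inr p))) := by
  have small : ∀ Γ : List (L.Srt ⊕ ι),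
      #(((v : V) × RepIdx E (σ v)) ⊕ ((k : Fin Γ.length) × RepIdx E (Γ.get k))) < κ := by
    intro Γ
    rw [mk_sum, lift_id, lift_id]
    have h₁ := mk_sigma_lt hκ fun v => mk_repIdx_lt E hκ hsmall (σ v)
    have h₂ := mk_sigma_lt hκ fun k => mk_repIdx_lt E hκ hsmall (Γ.get k)
    rw [lift_id] at h₁
    rw [lift_uzero] at h₂
    exact add_lt_of_lt hκ.le h₁ h₂
  induction φ with
  | @eq Γ s t₁ t₂ =>
    obtain ⟨f₁, hf₁⟩ := t₁.exists_representatives E U hE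
    obtain ⟨f₂, hf₂⟩ := t₂.exists_representatives E U hE
    refine ((typeDefinable_heqClass_eq E U hE s).inst
      (fun j => match j with | .inl j => f₁ j | .inr j => f₂ j)).of_iff fun c => ?_
    simp only [BForm.Holds, ← hf₁, ← hf₂]
    rfl
  | @rel Γ R args =>
    choose f hf using fun k => (args k).exists_representatives E U hE
    rcases R with R | ⟨n, d, φ⟩
    · refine (typeDefinable_sat (BForm.rel R fun k => f k PUnit.unit)).of_iff fun c => ?_
      simp only [BForm.Holds, ← hf]
      rfl
    · let ρ := Sum.elim (repVars E σ) (repVars E Γ.get)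
      have h₁ : TypeDefinable U (fun c : Tuple U (Sum.elim ρ (repCtx E d)) =>
          Sat U φ fun p => c (.inr p)) :=
        (typeDefinable_sat φ).inst fun p => .fvar (σ := Sum.elim ρ (repCtx E d)) (.inr p)
      have h₂ : TypeDefinable U (fun c : Tuple U (Sum.elim ρ (repCtx E d)) => ∀ k : Fin n,
          heqClass E U hE (d k) (fun j => c (.inr ⟨k, j⟩)) = heqClass E U hE (d k)
            (fun j => (f k j).val (Γ := []) U (fun v => c (.inl v)) (fun k => k.elim0))) := by
        refine TypeDefinable.forall fun k => ?_
        refine ((typeDefinable_heqClass_eq E U hE (d k)).inst (fun j => match j with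
          | .inl j => Term.fvar (σ := Sum.elim ρ (repCtx E d)) (.inr ⟨k, j⟩)
          | .inr j => (f k j).subst (fun v => .fvar (σ := Sum.elim ρ (repCtx E d)) (.inl v))
              (fun k : Fin 0 => k.elim0))).of_iff fun c => ?_
        refine iff_of_eq (congrArg _ (congrArg _ (funext fun j => ?_)))
        refine Eq.trans ?_ (Term.val_subst _ _ U c _ (f k j)).symm
        exact congrArg (fun e => Term.val (Γ := []) U (fun v => c (.inl v)) e (f k j))
          (funext fun k : Fin 0 => k.elim0)
      have hsm : #(PosForm L (Sum.elim ρ (repCtx E d))) < κ := by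
        refine mk_posForm_lt hκ hL ?_ _
        rw [mk_sum, lift_id, lift_id]
        have h := mk_sigma_lt hκ fun k => mk_repIdx_lt E hκ hsmall (d k)
        rw [lift_uzero] at h
        exact add_lt_of_lt hκ.le (small Γ) h
      refine ((h₂.and h₁).exists hU hsm).of_iff fun c => ?_
      constructor
      · rintro ⟨a, ha, h⟩
        refine ⟨fun p => a p.1 p.2, fun k => ?_, h⟩
        exact ((represents_iff E U hE _ _).1 (ha k)).trans (hf k c).symm
      · rintro ⟨b, hb, h⟩
        exact ⟨fun k j => b ⟨k, j⟩,
          fun k => (represents_iff E U hE _ _).2 ((hb k).trans (hf k c)), h⟩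
  | top => exact (typeDefinable_sat .top).of_iff fun c => Iff.rfl
  | bot => exact (typeDefinable_sat .bot).of_iff fun c => Iff.rfl
  | and φ ψ ih₁ ih₂ => exact ih₁.and ih₂
  | or φ ψ ih₁ ih₂ => exact ih₁.or ih₂
  | @ex Γ s φ ih =>
    -- Quantifying over a class means quantifying over a representative; `g` and `f` move the
    -- representative of the first bound variable into a separate last block, which is then
    -- projected away.
    let ρ := Sum.elim (repVars E σ) (repVars E Γ.get)
    let g : ∀ (k : Fin (s :: Γ).length) (j : RepIdx E ((s :: Γ).get k)),
        Term L (Sum.elim ρ (repSrt E s)) [] (repSrt E ((s :: Γ).get k) j) :=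
      Fin.cases (fun j => .fvar (σ := Sum.elim ρ (repSrt E s)) (.inr j))
        (fun k j => .fvar (σ := Sum.elim ρ (repSrt E s)) (.inl (.inr ⟨k, j⟩)))
    let f : ∀ v, Term L (Sum.elim ρ (repSrt E s)) []
        (Sum.elim (repVars E σ) (repVars E (s :: Γ).get) v) := fun v => match v with
      | .inl p => .fvar (σ := Sum.elim ρ (repSrt E s)) (.inl (.inl p))
      | .inr p => g p.1 p.2
    have hsm : #(PosForm L (Sum.elim ρ (repSrt E s))) < κ := by
      refine mk_posForm_lt hκ hL ?_ _
      rw [mk_sum, lift_id, lift_id]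
      exact add_lt_of_lt hκ.le (small Γ) (mk_repIdx_lt E hκ hsmall s)
    refine ((ih.inst f).exists hU hsm).of_iff fun c => ?_
    have key : ∀ b : Tuple U (repSrt E s),
        φ.Holds (heqStruc E U hE) (heqTuple E U hE fun p => c (.inl p))
          (Fin.cons (α := fun k => (heqStruc E U hE).carrier ((s :: Γ).get k))
            (heqClass E U hE s b) (heqTuple E U hE fun p => c (.inr p))) ↔
        φ.Holds (heqStruc E U hE)
          (heqTuple E U hE fun p =>
            (f (.inl p)).val (Γ := []) U (Tuple.append c b) (fun k => k.elim0))
          (heqTuple E U hE fun p =>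
            (f (.inr p)).val (Γ := []) U (Tuple.append c b) (fun k => k.elim0)) := by
      intro b
      refine iff_of_eq (congrArg (φ.Holds (heqStruc E U hE) _) (funext fun k => ?_))
      exact Fin.cases rfl (fun k => rfl) k
    constructor
    · rintro ⟨x, hx⟩
      obtain ⟨b, rfl⟩ := heqClass_surjective E U hE s x
      exact ⟨b, (key b).1 hx⟩
    · rintro ⟨b, hb⟩
      exact ⟨_, (key b).2 hb⟩

end Heq

/-! ### Finite shattering and the independence property -/

section Shattering

open Cardinal

variable {L : Signature.{u}} {X Y : Type u} {σ : X → L.Srt} {τ : Y → L.Srt}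

/-- The pair of positive formulas `φ(x;y)`, `ψ(x;y)` shatters a set of size `n` in `A`. -/
def Shatters (A : Struc L) (φ ψ : PosForm L (Sum.elim σ τ)) (n : ℕ) : Prop :=
  ∃ (a : Fin n → Tuple A σ) (b : Set (Fin n) → Tuple A τ), ∀ (i : Fin n) (W : Set (Fin n)),
    (i ∈ W → Sat A φ ((a i).append (b W))) ∧ (i ∉ W → Sat A ψ ((a i).append (b W)))

/-- Only the finitely many `b W` are quantified. The points `a i` stay free, so that these formulas
for varying `n` can be imposed on one infinite sequence. -/
theorem exists_shattering_formula [Finite Y] (φ ψ : PosForm L (Sum.elim σ τ)) (n : ℕ) :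
    ∃ χ : PosForm L (fun p : Fin n × X => σ p.2), ∀ (A : Struc L) (a : Fin n → Tuple A σ),
      Sat A χ (fun p => a p.1 p.2) ↔ ∃ b : Set (Fin n) → Tuple A τ,
        ∀ (i : Fin n) (W : Set (Fin n)), (i ∈ W → Sat A φ ((a i).append (b W))) ∧
          (i ∉ W → Sat A ψ ((a i).append (b W))) := by
  classical
  let ρ : (Fin n × X) ⊕ (Set (Fin n) × Y) → L.Srt :=
    Sum.elim (fun p : Fin n × X => σ p.2) (fun p : Set (Fin n) × Y => τ p.2)
  let f : Fin n × Set (Fin n) → ∀ v, Term L ρ [] (Sum.elim σ τ v) := fun p v => match v with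
    | .inl x => .fvar (σ := ρ) (.inl (p.1, x))
    | .inr y => .fvar (σ := ρ) (.inr (p.2, y))
  obtain ⟨θ, hθ⟩ := exists_conj fun p : Fin n × Set (Fin n) =>
    if p.1 ∈ p.2 then BForm.inst φ (f p) else BForm.inst ψ (f p)
  obtain ⟨χ, hχ⟩ := exists_ex θ
  have key : ∀ (A : Struc L) (a : Fin n → Tuple A σ) (b : Set (Fin n) → Tuple A τ)
      (ξ : PosForm L (Sum.elim σ τ)) (p : Fin n × Set (Fin n)),
      Sat A (ξ.inst (f p)) (Tuple.append (σ := fun p : Fin n × X => σ p.2)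
        (τ := fun p : Set (Fin n) × Y => τ p.2) (fun p => a p.1 p.2) (fun p => b p.1 p.2)) ↔
      Sat A ξ ((a p.1).append (b p.2)) := by
    intro A a b ξ p
    rw [sat_inst]
    refine iff_of_eq (congrArg (Sat A ξ) (funext fun v => ?_))
    cases v <;> rfl
  have key' : ∀ (A : Struc L) (a : Fin n → Tuple A σ) (b : Set (Fin n) → Tuple A τ),
      Sat A θ (Tuple.append (σ := fun p : Fin n × X => σ p.2)
        (τ := fun p : Set (Fin n) × Y => τ p.2) (fun p => a p.1 p.2) (fun p => b p.1 p.2)) ↔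
      ∀ (i : Fin n) (W : Set (Fin n)), (i ∈ W → Sat A φ ((a i).append (b W))) ∧
          (i ∉ W → Sat A ψ ((a i).append (b W))) := by
    intro A a b
    rw [hθ, Prod.forall]
    refine forall₂_congr fun i W => ?_
    by_cases h : i ∈ W <;> simp [h, key]
  refine ⟨χ, fun A a => (hχ A _).trans ⟨?_, ?_⟩⟩
  · rintro ⟨b, hb⟩
    exact ⟨fun W y => b (W, y), (key' A a fun W y => b (W, y)).1 hb⟩
  · rintro ⟨b, hb⟩
    exact ⟨fun p => b p.1 p.2, (key' A a b).2 hb⟩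

/-- Shattering is expressed by a positive sentence `δ`; if it failed in `B`, the h-inductive
sentence `δ → ⊥` would pass to `A`. -/
theorem shatters_of_forall_hSentence [Finite X] [Finite Y] {A B : Struc L}
    (hAB : ∀ θ : HSentence L, θ.True B → θ.True A) {φ ψ : PosForm L (Sum.elim σ τ)} {n : ℕ}
    (h : Shatters A φ ψ n) : Shatters B φ ψ n := by
  obtain ⟨χ, hχ⟩ := exists_shattering_formula φ ψ n
  obtain ⟨δ, hδ⟩ := exists_ex (BForm.weaken (fun v : PEmpty.{u+1} => v.elim) χ)
  have key : ∀ C : Struc L, Sat C δ (fun v => v.elim) ↔ Shatters C φ ψ n := by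
    intro C
    rw [hδ]
    simp only [sat_weaken]
    constructor
    · rintro ⟨a, ha⟩
      exact ⟨fun i x => a (i, x), (hχ C fun i x => a (i, x)).1 ha⟩
    · rintro ⟨a, ha⟩
      exact ⟨fun p => a p.1 p.2, (hχ C a).2 ha⟩
  by_contra hB
  refine hAB ⟨[], δ, .bot⟩ (fun e he => hB ((key B).1 ?_)) (fun k => k.elim0) ((key A).2 h)
  exact cast (congrArg (δ.Holds B _) (funext fun k : Fin 0 => k.elim0)) he

variable {T : Theory L} {κ : Cardinal.{u}} {U : Struc L}

/-- Saturation is used twice: for one sequence whose initial segments are all shattered, then, over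
that sequence, for a `b` for each `W ⊆ ℕ`. -/
theorem Theory.IsMonster.hasIP_of_shatters (hU : T.IsMonster κ U) (hκ : ℵ₀ < κ)
    [Finite X] [Finite Y] {φ ψ : PosForm L (Sum.elim σ τ)} (hc : T.Contradictory φ ψ)
    (h : ∀ n, Shatters U φ ψ n) : T.HasIP φ := by
  classical
  let ρ : ℕ × X → L.Srt := fun p => σ p.2
  choose χ hχ using exists_shattering_formula φ ψ
  obtain ⟨a, ha⟩ : ∃ a : Tuple U ρ, ∀ n, Sat U (χ n) (fun p => a (p.1, p.2)) := by
    let S : ℕ → PosForm L (Sum.elim (fun v : PEmpty.{u+1} => v.elim) ρ) := fun n =>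
      BForm.weaken _ (BForm.inst (χ n) fun p => .fvar (σ := ρ) (p.1.1, p.2))
    have hS : ∀ n (a : Tuple U ρ), Sat U (S n) (Tuple.append (fun v => v.elim) a) ↔
        Sat U (χ n) (fun p => a (p.1, p.2)) := fun n a =>
      (sat_weaken _ _ _).trans (sat_inst U (χ n) _ _)
    obtain ⟨a, ha⟩ := hU.exists_realization_seq hκ (fun v => v.elim) S fun n => by
      obtain ⟨a, b, hab⟩ := h (n + 1)
      -- The shattered set is repeated periodically. The period `n + 1` is nonzero and exceeds every
      -- `m < n`, so there is no wrap-around among the indices that matter.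
      refine ⟨fun p => a (Fin.ofNat (n + 1) p.1) p.2, fun m hm => (hS _ _).2 ?_⟩
      refine (hχ m U fun i => a (Fin.ofNat (n + 1) i)).2
        ⟨fun W => b {j | ∃ i ∈ W, Fin.ofNat (n + 1) i = j}, fun i W => ?_⟩
      have hi : Fin.ofNat (n + 1) i ∈ {j | ∃ i ∈ W, Fin.ofNat (n + 1) (i : Fin m).1 = j} ↔
          i ∈ W := by
        refine ⟨fun ⟨j, hj, hij⟩ => ?_, fun hi => ⟨i, hi, rfl⟩⟩
        have := congrArg Fin.val hij
        simp only [Fin.ofNat, Nat.mod_eq_of_lt (show (i : ℕ) < n + 1 by omega),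
          Nat.mod_eq_of_lt (show (j : ℕ) < n + 1 by omega)] at this
        exact Fin.ext this ▸ hj
      exact ⟨fun hW => (hab _ _).1 (hi.2 hW), fun hW => (hab _ _).2 (mt hi.1 hW)⟩
    exact ⟨a, fun n => (hS n a).1 (ha n)⟩
  have hb : ∀ W : Set ℕ, ∃ b : Tuple U τ, ∀ i,
      (i ∈ W → Sat U φ (Tuple.append (fun x => a (i, x)) b)) ∧
      (i ∉ W → Sat U ψ (Tuple.append (fun x => a (i, x)) b)) := by
    intro W
    let f : ℕ → ∀ v, Term L (Sum.elim ρ τ) [] (Sum.elim σ τ v) := fun i v => match v with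
      | .inl x => .fvar (σ := Sum.elim ρ τ) (.inl (i, x))
      | .inr y => .fvar (σ := Sum.elim ρ τ) (.inr y)
    have key : ∀ i (ξ : PosForm L (Sum.elim σ τ)) (b : Tuple U τ),
        Sat U (ξ.inst (f i)) (a.append b) ↔
          Sat U ξ (Tuple.append (fun x => a (i, x)) b) := by
      intro i ξ b
      rw [sat_inst]
      refine iff_of_eq (congrArg (Sat U ξ) (funext fun v => ?_))
      cases v <;> rfl
    obtain ⟨b, hb⟩ := hU.exists_realization_seq hκ a
      (fun i => if i ∈ W then BForm.inst φ (f i) else BForm.inst ψ (f i)) fun n => by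
        obtain ⟨b, hb⟩ := (hχ n U fun i x => a (i, x)).1 (ha n)
        refine ⟨b {i | i.1 ∈ W}, fun i hi => ?_⟩
        have := hb ⟨i, hi⟩ {i | i.1 ∈ W}
        by_cases hW : i ∈ W
        · rw [if_pos hW, key]
          exact this.1 hW
        · rw [if_neg hW, key]
          exact this.2 hW
    refine ⟨b, fun i => ?_⟩
    have := hb i
    by_cases hW : i ∈ W <;> simp only [hW, if_true, if_false, key] at this <;> simpa [hW] using this
  choose b hb using hb
  exact ⟨ψ, U, fun i x => a (i, x), b, hc, hU.pec.1, fun i W => hb W i⟩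

/-- A common realization in any model of `T` maps into a joint continuation with `U`, and the
immersion of `U` reflects its existence back. -/
theorem Theory.IsMonster.contradictory [Finite X] (hU : T.IsMonster κ U) (hJCP : T.JCP)
    {φ ψ : PosForm L σ} (h : ∀ a : Tuple U σ, ¬ (Sat U φ a ∧ Sat U ψ a)) :
    T.Contradictory φ ψ := by
  intro A hA a ha
  obtain ⟨B, hB, ⟨f⟩, ⟨g⟩⟩ := hJCP U A hU.pec.1 hA
  obtain ⟨δ, hδ⟩ := exists_ex (BForm.weaken (fun v : PEmpty.{u+1} => v.elim) (BForm.and φ ψ))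
  obtain ⟨b, hb⟩ := (hδ U (fun v => v.elim)).1 (hU.pec.2 B hB f _ δ (fun v => v.elim)
    ((hδ B _).2 ⟨_, (sat_weaken _ _ _).2 (g.map_sat (BForm.and φ ψ) a ha)⟩))
  exact h b ((sat_weaken _ _ _).1 hb)

end Shattering

/-! ### Separation by positive formulas and transfer of NIP -/

section HeqNIP

open Cardinal

variable {L : Signature.{u}} {T : Theory L} {κ : Cardinal.{u}} {U : Struc L}

/-- Compactness: if no such pair existed, every finite part `F` of `S ∪ R` would be realized, by
splitting it into `F ∩ S` and `F ∩ R`, and then so would the whole. -/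
theorem Theory.IsMonster.exists_finite_conj_inconsistent {V : Type u} {σ : V → L.Srt}
    (hU : T.IsMonster κ U) (hσ : #(PosForm L σ) < κ) {P Q : Tuple U σ → Prop}
    (hP : TypeDefinable U P) (hQ : TypeDefinable U Q) (h : ∀ a, ¬ (P a ∧ Q a)) :
    ∃ φ ψ : PosForm L σ, (∀ a, P a → Sat U φ a) ∧ (∀ a, Q a → Sat U ψ a) ∧
      ∀ a, ¬ (Sat U φ a ∧ Sat U ψ a) := by
  obtain ⟨S, hS⟩ := hP
  obtain ⟨R, hR⟩ := hQ
  by_contra! hc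
  obtain ⟨a, ha⟩ := hU.exists_realization (σ := fun v : PEmpty.{u+1} => v.elim)
    (fun v => v.elim) (S := BForm.weaken _ '' (S ∪ R))
    (mk_image_le.trans_lt ((mk_set_le _).trans_lt hσ)) fun F hF hfin => by
      obtain ⟨F, hF', hfin', rfl⟩ := (Set.exists_subset_image_finite_and
        (p := fun t => t = F)).1 ⟨F, hF, hfin, rfl⟩
      have := (hfin'.subset (Set.inter_subset_left (t := S))).to_subtype
      have := (hfin'.subset (Set.inter_subset_left (t := R))).to_subtype
      obtain ⟨φ, hφ⟩ := exists_conj fun i : (F ∩ S : Set _) => i.1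
      obtain ⟨ψ, hψ⟩ := exists_conj fun i : (F ∩ R : Set _) => i.1
      obtain ⟨a, ha⟩ := hc φ ψ (fun a ha => (hφ U a).2 fun i => (hS a).1 ha _ i.2.2)
        (fun a ha => (hψ U a).2 fun i => (hR a).1 ha _ i.2.2)
      refine ⟨a, ?_⟩
      rintro _ ⟨θ, hθ, rfl⟩
      refine (sat_weaken _ _ _).2 ?_
      rcases hF' hθ with h | h
      · exact (hφ U a).1 ha.1 ⟨θ, hθ, h⟩
      · exact (hψ U a).1 ha.2 ⟨θ, hθ, h⟩
  have ha' : ∀ θ ∈ S ∪ R, Sat U θ a := fun θ hθ => (sat_weaken _ _ _).1 (ha _ ⟨θ, hθ, rfl⟩)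
  exact h a ⟨(hS a).2 fun θ hθ => ha' θ (.inl hθ), (hR a).2 fun θ hθ => ha' θ (.inr hθ)⟩

variable {ι : Type u} (E : ι → BinaryType L) (hE : ∀ i, Equivalence ((E i).Rel U))

theorem typeDefinable_sat_heq (hU : T.IsMonster κ U) (hκ : ℵ₀ < κ) (hL : L.card < κ)
    (hsmall : ∀ i, #(E i).Idx < κ) {X Y : Type u} [Finite X] [Finite Y]
    {σ : X → L.Srt ⊕ ι} {τ : Y → L.Srt ⊕ ι}
    (φ : PosForm (heqSignature E) (Sum.elim σ τ)) :
    TypeDefinable U (fun c : Tuple U (Sum.elim (repVars E σ) (repVars E τ)) =>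
      Sat (heqStruc E U hE) φ (Tuple.append (heqTuple E U hE fun p => c (.inl p))
        (heqTuple E U hE fun p => c (.inr p)))) := by
  let f : ∀ v, Term L (Sum.elim (repVars E σ) (repVars E τ)) []
      (Sum.elim (repVars E (Sum.elim σ τ)) (repVars E ([] : List (L.Srt ⊕ ι)).get) v) :=
    fun v => match v with
    | .inl ⟨.inl x, j⟩ => .fvar (σ := Sum.elim (repVars E σ) (repVars E τ)) (.inl ⟨x, j⟩)
    | .inl ⟨.inr y, j⟩ => .fvar (σ := Sum.elim (repVars E σ) (repVars E τ)) (.inr ⟨y, j⟩)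
    | .inr p => p.1.elim0
  refine ((typeDefinable_holds_heq E U hE hU hκ hL hsmall φ).inst f).of_iff fun c => ?_
  refine iff_of_eq (congrArg₂ (φ.Holds (heqStruc E U hE)) (funext fun v => ?_)
    (funext fun k : Fin 0 => k.elim0))
  cases v <;> rfl

theorem heqTheory_nip (hJCP : T.JCP) (hκ : ℵ₀ < κ) (hL : L.card < κ) (hU : T.IsMonster κ U)
    (hsmall : ∀ i, #(E i).Idx < κ) (hNIP : T.NIP) : (heqTheory E U hE).NIP := by
  intro X Y _ _ σ τ φ hIP
  obtain ⟨ψ, A, a, b, hc, hA, hab⟩ := hIP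
  have hsh : ∀ n, Shatters (heqStruc E U hE) φ ψ n := fun n =>
    shatters_of_forall_hSentence (A := A) (fun θ hθ => hA θ hθ)
      ⟨fun i => a i, fun W => b (Fin.val '' W), fun i W => by
        simpa [Fin.val_inj] using hab i (Fin.val '' W)⟩
  have hc' := hc (heqStruc E U hE) fun θ hθ => hθ
  have hφ := typeDefinable_sat_heq E hE hU hκ hL hsmall φ
  have hψ := typeDefinable_sat_heq E hE hU hκ hL hsmall ψ
  have hsm : #(PosForm L (Sum.elim (repVars E σ) (repVars E τ))) < κ := by
    refine mk_posForm_lt hκ hL ?_ _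
    have h₁ := mk_sigma_lt hκ fun x => mk_repIdx_lt E hκ hsmall (σ x)
    have h₂ := mk_sigma_lt hκ fun y => mk_repIdx_lt E hκ hsmall (τ y)
    rw [lift_id] at h₁ h₂
    rw [mk_sum, lift_id, lift_id]
    exact add_lt_of_lt hκ.le h₁ h₂
  obtain ⟨φ₀, ψ₀, hφ₀, hψ₀, hc₀⟩ := hU.exists_finite_conj_inconsistent hsm hφ hψ fun c => hc' _
  obtain ⟨F₁, G₁, hF₁, hG₁, h₁⟩ := exists_restrict_sum φ₀
  obtain ⟨F₂, G₂, hF₂, hG₂, h₂⟩ := exists_restrict_sum ψ₀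
  -- NIP of `T` concerns finite tuples, and both formulas must share the same ones.
  obtain ⟨φ', hφ'⟩ := h₁ (F₁ ∪ F₂) Set.subset_union_left (G₁ ∪ G₂) Set.subset_union_left
  obtain ⟨ψ', hψ'⟩ := h₂ (F₁ ∪ F₂) Set.subset_union_right (G₁ ∪ G₂) Set.subset_union_right
  have := (hF₁.union hF₂).to_subtype
  have := (hG₁.union hG₂).to_subtype
  have hsh' : ∀ n, ∃ (a : Fin n → Tuple U (repVars E σ))
      (b : Set (Fin n) → Tuple U (repVars E τ)), ∀ (i : Fin n) (W : Set (Fin n)),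
      (i ∈ W → Sat U φ₀ ((a i).append (b W))) ∧ (i ∉ W → Sat U ψ₀ ((a i).append (b W))) := by
    intro n
    obtain ⟨a, b, hab⟩ := hsh n
    choose a' ha' using fun i => heqTuple_surjective E U hE σ (a i)
    choose b' hb' using fun W => heqTuple_surjective E U hE τ (b W)
    refine ⟨a', b', fun i W => ⟨fun hW => hφ₀ _ ?_, fun hW => hψ₀ _ ?_⟩⟩
    · have := (hab i W).1 hW
      rw [← ha', ← hb'] at this
      exact this
    · have := (hab i W).2 hW
      rw [← ha', ← hb'] at this
      exact this
  refine hNIP _ _ φ' (hU.hasIP_of_shatters (ψ := ψ') hκ (hU.contradictory hJCP ?_) fun n => ?_)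
  · classical
    rintro c ⟨hcφ, hcψ⟩
    -- Inconsistency of `φ₀` and `ψ₀` is known only for full tuples, so `c` has to be extended. The
    -- witnesses for `n = 1` show that all the sorts are inhabited and supply the default values.
    obtain ⟨a₀, b₀, -⟩ := hsh' 1
    let a : Tuple U (repVars E σ) := fun v =>
      if h : v ∈ F₁ ∪ F₂ then c (.inl ⟨v, h⟩) else a₀ 0 v
    let b : Tuple U (repVars E τ) := fun w =>
      if h : w ∈ G₁ ∪ G₂ then c (.inr ⟨w, h⟩) else b₀ ∅ w
    have hcab : c = Tuple.append (σ := fun v : (F₁ ∪ F₂ : Set _) => repVars E σ v)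
        (τ := fun w : (G₁ ∪ G₂ : Set _) => repVars E τ w) (fun v => a v) (fun w => b w) := by
      funext v
      rcases v with v | w
      · have h : a v = c (.inl v) := dif_pos v.2
        exact h.symm
      · have h : b w = c (.inr w) := dif_pos w.2
        exact h.symm
    rw [hcab] at hcφ hcψ
    exact hc₀ _ ⟨(hφ' U a b).1 hcφ, (hψ' U a b).1 hcψ⟩
  · obtain ⟨a, b, hab⟩ := hsh' n
    exact ⟨fun i v => a i v, fun W w => b W w, fun i W =>
      ⟨fun hW => (hφ' U (a i) (b W)).2 ((hab i W).1 hW),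
        fun hW => (hψ' U (a i) (b W)).2 ((hab i W).2 hW)⟩⟩

end HeqNIP

end PosLogic

theorem mainTheorem12 (L : Signature.{u}) (T : Theory L) (hJCP : T.JCP)
    (κ : Cardinal.{u}) (hκ : Cardinal.aleph0 < κ) (hL : L.card < κ)
    (U : Struc L) (hU : T.IsMonster κ U)
    (ι : Type u) (E : ι → BinaryType L) (hsmall : ∀ i, Cardinal.mk (E i).Idx < κ)
    (hE : ∀ i, Equivalence ((E i).Rel U))
    (hNIP : T.NIP) :
    (heqTheory E U hE).NIP :=
  heqTheory_nip E hE hJCP hκ hL hU hsmall hNIP
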